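/- Let $\mathbb R_+=(0,\infty)$. For $q,r\in\mathbb R$ and positive reals $x_1,\dots,x_n$ ($n\ge 1$), the Gini mean is $$\mathscr G_{q,r}(x_1,\dots,x_n)=\begin{cases}\Big(\dfrac{x_1^q+\cdots+x_n^q}{x_1^r+\cdots+x_n^r}\Big)^{\frac1{q-r}} & q\ne r,\\[3mm] \exp\Big(\dfrac{x_1^q\log x_1+\cdots+x_n^q\log x_n}{x_1^q+\cdots+x_n^q}\Big) & q=r.\end{cases}$$ It is called Jensen convex on an interval $I\subseteq\mathbb R_+$ if, for all $n\ge1$ and all $x,y\in I^n$, $\mathscr G_{q,r}\big(\frac{x+y}2\big)\le\frac{\mathscr G_{q,r}(x)+\mathscr G_{q,r}(y)}2$. Put, for $t\in\mathbb R_+$, $$\gamma_{q,r}(t)=\begin{cases}\dfrac{t^q-t^r}{q-r} & q\neq r,\\[2mm] t^q\log t & q=r,\end{cases}\qquad \beta_{q,r}=\begin{cases}\Big(\dfrac{q(q-1)}{r(r-1)}\Big)^{\frac1{q-r}} & q\ne r \text{ and } qr(q-1)(r-1)>0,\\[2mm] \exp\Big(\dfrac1q+\dfrac1{q-1}\Big)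 & q=r \text{ and } q(q-1)\ne0,\end{cases}$$ where $\beta_{q,r}$ is left undefined in all other cases. **Theorem.** Let $q,r\in\mathbb R$ and $0<a<b<\infty$. Then the following three assertions are equivalent. (i) The mean $\mathscr G_{q,r}$ is Jensen convex on $(a,b)$. (ii) The function $\gamma_{q,r}$ is convex on the closed interval $\big[\frac ab,\frac ba\big]$. (iii) At least one of the following conditions holds (an inequality involving $\beta_{q,r}$ is understood to include that $\beta_{q,r}$ is defined): 1. $0\le\min(q,r)\le1\le\max(q,r)$; 2. $\max(q,r)<1\le q+r$ and $\beta_{q,r}\le\frac ab$; 3. $\min(q,r)\le0$, $1\le q+r$ and $\beta_{q,r}\ge\frac ba$; 4. $1\le\min(q,r)$ and $\beta_{q,r}\ge\frac ba$. -/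

import Mathlib

noncomputable section

/-- The Gini mean `G_{q,r}` of `n` positive real numbers. -/
def giniMean (q r : ℝ) (n : ℕ) (x : Fin n → ℝ) : ℝ :=
  if q ≠ r then
    ((∑ i, x i ^ q) / (∑ i, x i ^ r)) ^ (1 / (q - r))
  else
    Real.exp ((∑ i, x i ^ q * Real.log (x i)) / (∑ i, x i ^ q))

/-- A mean `M`, i.e. a family of `n`-variable functions, is Jensen convex on `I` if, for every
number `n ≥ 1` of variables, its restriction to `I ^ n` satisfies the midpoint convexity
inequality. -/
def IsJensenConvexMeanOn (M : (n : ℕ) → (Fin n → ℝ) → ℝ) (I : Set ℝ) : Prop :=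
  ∀ n : ℕ, 1 ≤ n → ∀ x y : Fin n → ℝ, (∀ i, x i ∈ I) → (∀ i, y i ∈ I) →
    M n (fun i => (x i + y i) / 2) ≤ (M n x + M n y) / 2

/-- The function `γ_{q,r}` on the positive reals. -/
def giniGamma (q r t : ℝ) : ℝ :=
  if q ≠ r then (t ^ q - t ^ r) / (q - r) else t ^ q * Real.log t

/-- The condition under which the constant `β_{q,r}` is defined. -/
def GiniBetaDefined (q r : ℝ) : Prop :=
  (q ≠ r ∧ 0 < q * r * (q - 1) * (r - 1)) ∨ (q = r ∧ q * (q - 1) ≠ 0)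

/-- The constant `β_{q,r}`; its value is meaningful only under `GiniBetaDefined q r`. -/
def giniBeta (q r : ℝ) : ℝ :=
  if q ≠ r then
    ((q * (q - 1)) / (r * (r - 1))) ^ (1 / (q - r))
  else
    Real.exp (1 / q + 1 / (q - 1))

end

/-! All three assertions are equivalent to `γ'' ≥ 0` on the open interval `(a/b, b/a)`. The link
between mean and `γ` is `giniMean_compare`: the mean of `x` is at most `y` exactly when `∑ γ (x i /
y) ≤ 0`. Convexity of `γ` then gives Jensen convexity by averaging the sums for `x` and `y` with
weights proportional to their means. Conversely, the mean of `u * p` and `m` copies of `u` is `u *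
(1 + γ p / m + o(1/m))`, because `γ 1 = 0` and `γ' 1 = 1`. The order `1/m` term of the Jensen
inequality is midpoint convexity of `γ`, which forces `γ'' ≥ 0`
(`giniGammaDerivTwo_nonneg_of_midpoint`). Where `β` is defined, `γ''` changes sign exactly at `1/β`;
elsewhere the signs of `q (q - 1)` and `r (r - 1)`, together with `γ'' 1 = q + r - 1`, decide. -/

open Filter Topology

/-! ### Derivatives and sign of `γ` -/

noncomputable section

/-- The second derivative of `giniGamma q r` on the positive reals. -/
def giniGammaDerivTwo (q r t : ℝ) : ℝ :=
  if q ≠ r then (q * (q - 1) * t ^ (q - 2) - r * (r - 1) * t ^ (r - 2)) / (q - r)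
  else (q * (q - 1) * Real.log t + (2 * q - 1)) * t ^ (q - 2)

/-- The first derivative of `giniGamma q r` on the positive reals. -/
def giniGammaDeriv (q r t : ℝ) : ℝ :=
  if q ≠ r then (q * t ^ (q - 1) - r * t ^ (r - 1)) / (q - r)
  else (q * Real.log t + 1) * t ^ (q - 1)

end

theorem hasDerivAt_giniGamma (q r : ℝ) {t : ℝ} (ht : 0 < t) :
    HasDerivAt (giniGamma q r) (giniGammaDeriv q r t) t := by
  have hq := Real.hasDerivAt_rpow_const (x := t) (p := q) (Or.inl ht.ne')
  by_cases h : q = r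
  · subst h
    have e : giniGamma q q = fun t => t ^ q * Real.log t := by
      funext s; simp [giniGamma]
    rw [e]
    refine (hq.mul (Real.hasDerivAt_log ht.ne')).congr_deriv ?_
    have h1 : t ^ q = t ^ (q - 1) * t := by
      rw [← Real.rpow_add_one ht.ne']; ring_nf
    simp only [giniGammaDeriv, ne_eq, not_true_eq_false, if_false]
    rw [h1]
    field_simp
  · have hr := Real.hasDerivAt_rpow_const (x := t) (p := r) (Or.inl ht.ne')
    have e : giniGamma q r = fun t => (t ^ q - t ^ r) / (q - r) := by
      funext s; simp [giniGamma, h]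
    rw [e]
    refine ((hq.sub hr).div_const _).congr_deriv ?_
    simp [giniGammaDeriv, h]

theorem hasDerivAt_giniGammaDeriv (q r : ℝ) {t : ℝ} (ht : 0 < t) :
    HasDerivAt (giniGammaDeriv q r) (giniGammaDerivTwo q r t) t := by
  have hq := Real.hasDerivAt_rpow_const (x := t) (p := q - 1) (Or.inl ht.ne')
  by_cases h : q = r
  · subst h
    have e : giniGammaDeriv q q = fun t => (q * Real.log t + 1) * t ^ (q - 1) := by
      funext s; simp [giniGammaDeriv]
    rw [e]
    refine ((((Real.hasDerivAt_log ht.ne').const_mul q).add_const 1).mul hq).congr_deriv ?_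
    have h1 : t ^ (q - 1) = t ^ (q - 2) * t := by
      rw [← Real.rpow_add_one ht.ne']; ring_nf
    have h2 : q - 1 - 1 = q - 2 := by ring
    simp only [giniGammaDerivTwo, ne_eq, not_true_eq_false, if_false]
    rw [h2, h1]
    field_simp
    ring
  · have hr := Real.hasDerivAt_rpow_const (x := t) (p := r - 1) (Or.inl ht.ne')
    have e : giniGammaDeriv q r = fun t => (q * t ^ (q - 1) - r * t ^ (r - 1)) / (q - r) := by
      funext s; simp [giniGammaDeriv, h]
    rw [e]
    refine (((hq.const_mul q).sub (hr.const_mul r)).div_const _).congr_deriv ?_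
    have h2 : q - 1 - 1 = q - 2 := by ring
    have h3 : r - 1 - 1 = r - 2 := by ring
    simp [giniGammaDerivTwo, h, h2, h3, mul_assoc]

theorem deriv_deriv_giniGamma (q r : ℝ) {t : ℝ} (ht : 0 < t) :
    deriv^[2] (giniGamma q r) t = giniGammaDerivTwo q r t := by
  have h : deriv (giniGamma q r) =ᶠ[𝓝 t] giniGammaDeriv q r := by
    filter_upwards [lt_mem_nhds ht] with s hs using (hasDerivAt_giniGamma q r hs).deriv
  rw [Function.iterate_succ, Function.iterate_one, Function.comp_apply, h.deriv_eq]
  exact (hasDerivAt_giniGammaDeriv q r ht).deriv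

theorem continuousAt_giniGammaDerivTwo (q r : ℝ) {t : ℝ} (ht : 0 < t) :
    ContinuousAt (giniGammaDerivTwo q r) t := by
  have hpow : ∀ p : ℝ, ContinuousAt (fun s : ℝ => s ^ p) t := fun p =>
    Real.continuousAt_rpow_const t p (Or.inl ht.ne')
  have hlog := Real.continuousAt_log ht.ne'
  by_cases h : q = r
  · have e : giniGammaDerivTwo q r =
        fun t => (q * (q - 1) * Real.log t + (2 * q - 1)) * t ^ (q - 2) := by
      funext s; simp [giniGammaDerivTwo, h]
    rw [e]
    exact ((hlog.const_mul _).add continuousAt_const).mul (hpow _)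
  · have e : giniGammaDerivTwo q r =
        fun t => (q * (q - 1) * t ^ (q - 2) - r * (r - 1) * t ^ (r - 2)) / (q - r) := by
      funext s; simp [giniGammaDerivTwo, h]
    rw [e]
    exact (((hpow _).const_mul _).sub ((hpow _).const_mul _)).div_const _

theorem continuousAt_giniGamma (q r : ℝ) {t : ℝ} (ht : 0 < t) :
    ContinuousAt (giniGamma q r) t :=
  (hasDerivAt_giniGamma q r ht).continuousAt

theorem giniGamma_one (q r : ℝ) : giniGamma q r 1 = 0 := by
  simp [giniGamma]

theorem giniGammaDeriv_one (q r : ℝ) : giniGammaDeriv q r 1 = 1 := by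
  by_cases h : q = r
  · simp [giniGammaDeriv, h]
  · simp [giniGammaDeriv, h, div_self (sub_ne_zero.mpr h)]

theorem giniGammaDerivTwo_one (q r : ℝ) : giniGammaDerivTwo q r 1 = q + r - 1 := by
  by_cases h : q = r
  · simp [giniGammaDerivTwo, h]; ring
  · have := sub_ne_zero.mpr h
    simp only [giniGammaDerivTwo, ne_eq, h, not_false_eq_true, if_true, Real.one_rpow]
    field_simp
    ring

theorem giniGamma_pos (q r : ℝ) {t : ℝ} (ht : 1 < t) : 0 < giniGamma q r t := by
  have h0 : 0 < t := one_pos.trans ht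
  rcases lt_trichotomy q r with h | h | h
  · simp only [giniGamma, h.ne, ne_eq, not_false_eq_true, if_true]
    exact div_pos_of_neg_of_neg (sub_neg.mpr (Real.rpow_lt_rpow_of_exponent_lt ht h))
      (sub_neg.mpr h)
  · simp only [giniGamma, h, ne_eq, not_true_eq_false, if_false]
    exact mul_pos (Real.rpow_pos_of_pos h0 _) (Real.log_pos ht)
  · simp only [giniGamma, h.ne', ne_eq, not_false_eq_true, if_true]
    exact div_pos (sub_pos.mpr (Real.rpow_lt_rpow_of_exponent_lt ht h)) (sub_pos.mpr h)

theorem giniGamma_neg (q r : ℝ) {t : ℝ} (h0 : 0 < t) (ht : t < 1) : giniGamma q r t < 0 := by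
  rcases lt_trichotomy q r with h | h | h
  · simp only [giniGamma, h.ne, ne_eq, not_false_eq_true, if_true]
    exact div_neg_of_pos_of_neg (sub_pos.mpr (Real.rpow_lt_rpow_of_exponent_gt h0 ht h))
      (sub_neg.mpr h)
  · simp only [giniGamma, h, ne_eq, not_true_eq_false, if_false]
    exact mul_neg_of_pos_of_neg (Real.rpow_pos_of_pos h0 _) (Real.log_neg h0 ht)
  · simp only [giniGamma, h.ne', ne_eq, not_false_eq_true, if_true]
    exact div_neg_of_neg_of_pos (sub_neg.mpr (Real.rpow_lt_rpow_of_exponent_gt h0 ht h))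
      (sub_pos.mpr h)

/-! ### Comparing the mean with a number through `γ` -/

theorem log_sub_log_div_nonneg_iff {P Q c : ℝ} (hP : 0 < P) (hQ : 0 < Q) (hc : c ≠ 0) :
    0 ≤ (Real.log P - Real.log Q) / c ↔ 0 ≤ (P - Q) / c := by
  rcases lt_or_gt_of_ne hc with h | h
  · rw [le_div_iff_of_neg h, le_div_iff_of_neg h, zero_mul, sub_nonpos, sub_nonpos,
      Real.log_le_log_iff hP hQ]
  · rw [le_div_iff₀ h, le_div_iff₀ h, zero_mul, sub_nonneg, sub_nonneg,
      Real.log_le_log_iff hQ hP]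

theorem log_sub_log_div_nonpos_iff {P Q c : ℝ} (hP : 0 < P) (hQ : 0 < Q) (hc : c ≠ 0) :
    (Real.log P - Real.log Q) / c ≤ 0 ↔ (P - Q) / c ≤ 0 := by
  have := log_sub_log_div_nonneg_iff hP hQ (neg_ne_zero.mpr hc)
  simpa only [div_neg, Left.nonneg_neg_iff] using this

theorem giniMean_pos (q r : ℝ) {n : ℕ} (hn : 1 ≤ n) {x : Fin n → ℝ} (hx : ∀ i, 0 < x i) :
    0 < giniMean q r n x := by
  have : Nonempty (Fin n) := ⟨⟨0, hn⟩⟩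
  have hS : ∀ p : ℝ, 0 < ∑ i, x i ^ p := fun p =>
    Finset.sum_pos (fun i _ => Real.rpow_pos_of_pos (hx i) p) Finset.univ_nonempty
  unfold giniMean
  split_ifs
  · exact Real.rpow_pos_of_pos (div_pos (hS q) (hS r)) _
  · exact Real.exp_pos _

/-- `log G - log y` and `∑ γ (x i / y)` have the same sign. -/
theorem giniMean_compare (q r : ℝ) {n : ℕ} (hn : 1 ≤ n) {x : Fin n → ℝ} (hx : ∀ i, 0 < x i)
    {y : ℝ} (hy : 0 < y) :
    (giniMean q r n x ≤ y ↔ ∑ i, giniGamma q r (x i / y) ≤ 0) ∧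
      (y ≤ giniMean q r n x ↔ 0 ≤ ∑ i, giniGamma q r (x i / y)) := by
  have : Nonempty (Fin n) := ⟨⟨0, hn⟩⟩
  have hS : ∀ p : ℝ, 0 < ∑ i, x i ^ p := fun p =>
    Finset.sum_pos (fun i _ => Real.rpow_pos_of_pos (hx i) p) Finset.univ_nonempty
  have hT : ∀ p : ℝ, ∑ i, (x i / y) ^ p = (∑ i, x i ^ p) / y ^ p := fun p => by
    rw [Finset.sum_div]
    exact Finset.sum_congr rfl fun i _ => Real.div_rpow (hx i).le hy.le p
  have hG := giniMean_pos q r hn hx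
  rw [← Real.log_le_log_iff hG hy, ← Real.log_le_log_iff hy hG, ← sub_nonpos,
    ← sub_nonneg (a := Real.log (giniMean q r n x))]
  by_cases h : q = r
  · have e : Real.log (giniMean q r n x) =
        (∑ i, x i ^ q * Real.log (x i)) / ∑ i, x i ^ q := by
      simp [giniMean, h]
    have e2 : ∑ i, giniGamma q r (x i / y) =
        (Real.log (giniMean q r n x) - Real.log y) * ((∑ i, x i ^ q) / y ^ q) := by
      have e3 : ∀ i, giniGamma q r (x i / y) =
          (x i ^ q * Real.log (x i) - x i ^ q * Real.log y) / y ^ q := fun i => by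
        simp only [giniGamma, h, ne_eq, not_true_eq_false, if_false]
        rw [Real.div_rpow (hx i).le hy.le, Real.log_div (hx i).ne' hy.ne']
        ring
      rw [Finset.sum_congr rfl fun i _ => e3 i, ← Finset.sum_div, Finset.sum_sub_distrib,
        ← Finset.sum_mul, e]
      have := (hS q).ne'
      field_simp
    have hc : 0 < (∑ i, x i ^ q) / y ^ q := div_pos (hS q) (Real.rpow_pos_of_pos hy q)
    rw [e2]
    exact ⟨by rw [← not_lt, ← not_lt, mul_pos_iff_of_pos_right hc], (mul_nonneg_iff_of_pos_right hc).symm⟩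
  · have hc : q - r ≠ 0 := sub_ne_zero.mpr h
    have hP : ∀ p : ℝ, 0 < (∑ i, x i ^ p) / y ^ p := fun p =>
      div_pos (hS p) (Real.rpow_pos_of_pos hy p)
    have e : Real.log (giniMean q r n x) - Real.log y =
        (Real.log ((∑ i, x i ^ q) / y ^ q) - Real.log ((∑ i, x i ^ r) / y ^ r)) / (q - r) := by
      simp only [giniMean, ne_eq, h, not_false_eq_true, if_true]
      rw [Real.log_rpow (div_pos (hS q) (hS r)), Real.log_div (hS q).ne' (hS r).ne',
        Real.log_div (hS q).ne' (Real.rpow_pos_of_pos hy q).ne',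
        Real.log_div (hS r).ne' (Real.rpow_pos_of_pos hy r).ne', Real.log_rpow hy,
        Real.log_rpow hy]
      field_simp
      ring
    have e2 : ∑ i, giniGamma q r (x i / y) =
        ((∑ i, x i ^ q) / y ^ q - (∑ i, x i ^ r) / y ^ r) / (q - r) := by
      simp only [giniGamma, ne_eq, h, not_false_eq_true, if_true]
      rw [← Finset.sum_div, Finset.sum_sub_distrib, hT, hT]
    rw [e, e2]
    exact ⟨log_sub_log_div_nonpos_iff (hP q) (hP r) hc,
      log_sub_log_div_nonneg_iff (hP q) (hP r) hc⟩

theorem giniMean_mem_Ioo (q r : ℝ) {n : ℕ} (hn : 1 ≤ n) {a b : ℝ} (ha : 0 < a)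
    {x : Fin n → ℝ} (hx : ∀ i, x i ∈ Set.Ioo a b) : giniMean q r n x ∈ Set.Ioo a b := by
  have : Nonempty (Fin n) := ⟨⟨0, hn⟩⟩
  have hx0 : ∀ i, 0 < x i := fun i => ha.trans (hx i).1
  have hb : 0 < b := (hx0 ⟨0, hn⟩).trans (hx ⟨0, hn⟩).2
  constructor
  · rw [← not_le, (giniMean_compare q r hn hx0 ha).1, not_le]
    exact Finset.sum_pos (fun i _ => giniGamma_pos q r ((one_lt_div ha).mpr (hx i).1))
      Finset.univ_nonempty
  · rw [← not_le, (giniMean_compare q r hn hx0 hb).2, not_le]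
    exact Finset.sum_neg (fun i _ => giniGamma_neg q r (div_pos (hx0 i) hb)
      ((div_lt_one hb).mpr (hx i).2)) Finset.univ_nonempty

/-! ### Convexity of `γ` implies Jensen convexity -/

theorem isJensenConvexMeanOn_giniMean_of_convexOn {q r a b : ℝ} (ha : 0 < a)
    (h : ConvexOn ℝ (Set.Icc (a / b) (b / a)) (giniGamma q r)) :
    IsJensenConvexMeanOn (giniMean q r) (Set.Ioo a b) := by
  intro n hn x y hx hy
  have hx0 : ∀ i, 0 < x i := fun i => ha.trans (hx i).1
  have hy0 : ∀ i, 0 < y i := fun i => ha.trans (hy i).1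
  have hu := giniMean_mem_Ioo q r hn ha hx
  have hv := giniMean_mem_Ioo q r hn ha hy
  have hsx := (giniMean_compare q r hn hx0 (ha.trans hu.1)).1.mp le_rfl
  have hsy := (giniMean_compare q r hn hy0 (ha.trans hv.1)).1.mp le_rfl
  set u := giniMean q r n x
  set v := giniMean q r n y
  have hu0 : 0 < u := ha.trans hu.1
  have hv0 : 0 < v := ha.trans hv.1
  have hmem : ∀ s w : ℝ, s ∈ Set.Ioo a b → w ∈ Set.Ioo a b →
      s / w ∈ Set.Icc (a / b) (b / a) := by
    intro s w hs hw
    have hw0 : 0 < w := ha.trans hw.1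
    have hb : 0 < b := hw0.trans hw.2
    exact ⟨div_le_div₀ (ha.trans hs.1).le hs.1.le hw0 hw.2.le,
      div_le_div₀ hb.le hs.2.le ha hw.1.le⟩
  rw [(giniMean_compare q r hn (fun i => by have := hx0 i; have := hy0 i; positivity)
    (by positivity : 0 < (u + v) / 2)).1]
  -- The quotient `(x i + y i) / (u + v)` is the convex combination of `x i / u` and `y i / v` with
  -- weights `u / (u + v)` and `v / (u + v)`, which do not depend on `i`, so the bound can be
  -- summed.
  have key : ∀ i, giniGamma q r ((x i + y i) / 2 / ((u + v) / 2)) ≤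
      u / (u + v) * giniGamma q r (x i / u) + v / (u + v) * giniGamma q r (y i / v) := by
    intro i
    have := h.2 (hmem _ _ (hx i) hu) (hmem _ _ (hy i) hv)
      (by positivity : 0 ≤ u / (u + v)) (by positivity : 0 ≤ v / (u + v)) (by field_simp)
    simp only [smul_eq_mul] at this
    have e : (x i + y i) / 2 / ((u + v) / 2) = u / (u + v) * (x i / u) + v / (u + v) * (y i / v) := by
      field_simp
    rwa [e]
  refine (Finset.sum_le_sum fun i _ => key i).trans ?_
  rw [Finset.sum_add_distrib, ← Finset.mul_sum, ← Finset.mul_sum]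
  exact add_nonpos (mul_nonpos_of_nonneg_of_nonpos (by positivity) hsx)
    (mul_nonpos_of_nonneg_of_nonpos (by positivity) hsy)

/-! ### Convexity of `γ` and the sign of `γ''` -/

/-- If `γ'' t < 0`, continuity of `γ''` makes `γ` strictly concave near `t`, against the midpoint
inequality for a small `δ > 0`. -/
theorem giniGammaDerivTwo_nonneg_of_midpoint {q r t : ℝ} (ht : 0 < t)
    (h : ∀ᶠ δ in 𝓝 (0 : ℝ), 2 * giniGamma q r t ≤ giniGamma q r (t - δ) + giniGamma q r (t + δ)) :
    0 ≤ giniGammaDerivTwo q r t := by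
  by_contra! hneg
  have h1 : ∀ᶠ s in 𝓝 t, 0 < s ∧ giniGammaDerivTwo q r s < 0 :=
    (lt_mem_nhds ht).and ((continuousAt_giniGammaDerivTwo q r ht).eventually_lt_const hneg)
  obtain ⟨ε, hε, hε'⟩ := Metric.eventually_nhds_iff.mp h1
  obtain ⟨η, hη, hη'⟩ := Metric.eventually_nhds_iff.mp h
  have hI : ∀ s ∈ Set.Ioo (t - ε) (t + ε), 0 < s ∧ giniGammaDerivTwo q r s < 0 := by
    intro s hs
    apply hε'
    rw [Real.dist_eq, abs_lt]
    constructor <;> linarith [hs.1, hs.2]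
  have hconc : StrictConcaveOn ℝ (Set.Ioo (t - ε) (t + ε)) (giniGamma q r) := by
    refine strictConcaveOn_of_deriv2_neg (convex_Ioo _ _)
      (fun s hs => (continuousAt_giniGamma q r (hI s hs).1).continuousWithinAt) fun s hs => ?_
    rw [interior_Ioo] at hs
    rw [deriv_deriv_giniGamma q r (hI s hs).1]
    exact (hI s hs).2
  obtain ⟨δ, hδ0, hδ⟩ := exists_between (lt_min hε hη)
  have hδε := hδ.trans_le (min_le_left _ _)
  have hδη := hδ.trans_le (min_le_right _ _)
  have hm := hη' (y := δ) (by rw [Real.dist_eq, sub_zero, abs_of_pos hδ0]; exact hδη)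
  have hs := hconc.2 (⟨by linarith, by linarith⟩ : t - δ ∈ Set.Ioo (t - ε) (t + ε))
    (⟨by linarith, by linarith⟩ : t + δ ∈ Set.Ioo (t - ε) (t + ε)) (by linarith) (one_half_pos (α := ℝ)) one_half_pos
    (add_halves 1)
  simp only [smul_eq_mul] at hs
  rw [show 1 / 2 * (t - δ) + 1 / 2 * (t + δ) = t by ring] at hs
  linarith

theorem giniGammaDerivTwo_nonneg_of_convexOn {q r : ℝ} {s : Set ℝ} (h : ConvexOn ℝ s (giniGamma q r))
    {t : ℝ} (ht : 0 < t) (hs : s ∈ 𝓝 t) : 0 ≤ giniGammaDerivTwo q r t := by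
  refine giniGammaDerivTwo_nonneg_of_midpoint ht ?_
  have h1 : ∀ᶠ δ in 𝓝 (0 : ℝ), t - δ ∈ s :=
    (Continuous.tendsto' (by fun_prop : Continuous fun δ : ℝ => t - δ) 0 t (by simp)) hs
  have h2 : ∀ᶠ δ in 𝓝 (0 : ℝ), t + δ ∈ s :=
    (Continuous.tendsto' (by fun_prop : Continuous fun δ : ℝ => t + δ) 0 t (by simp)) hs
  filter_upwards [h1, h2] with δ hd1 hd2
  have := h.2 hd1 hd2 (one_half_pos (α := ℝ)).le one_half_pos.le (add_halves 1)
  simp only [smul_eq_mul] at this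
  rw [show 1 / 2 * (t - δ) + 1 / 2 * (t + δ) = t by ring] at this
  linarith

theorem convexOn_giniGamma_of_nonneg {q r a b : ℝ} (ha : 0 < a)
    (h : ∀ t ∈ Set.Ioo a b, 0 ≤ giniGammaDerivTwo q r t) :
    ConvexOn ℝ (Set.Icc a b) (giniGamma q r) := by
  have hpos : ∀ t ∈ Set.Ioo a b, 0 < t := fun t ht => ha.trans ht.1
  refine convexOn_of_deriv2_nonneg (convex_Icc _ _)
    (fun t ht => (continuousAt_giniGamma q r (ha.trans_le ht.1)).continuousWithinAt)
    ?_ ?_ ?_ <;> rw [interior_Icc]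
  · exact fun t ht =>
      (hasDerivAt_giniGamma q r (hpos t ht)).differentiableAt.differentiableWithinAt
  · refine fun t ht => DifferentiableAt.differentiableWithinAt ?_
    have he : deriv (giniGamma q r) =ᶠ[𝓝 t] giniGammaDeriv q r := by
      filter_upwards [lt_mem_nhds (hpos t ht)] with s hs using (hasDerivAt_giniGamma q r hs).deriv
    exact he.differentiableAt_iff.mpr
      (hasDerivAt_giniGammaDeriv q r (hpos t ht)).differentiableAt
  · intro t ht
    rw [deriv_deriv_giniGamma q r (hpos t ht)]
    exact h t ht

/-! ### Jensen convexity implies midpoint convexity of `γ` -/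

/-- The second term is a difference quotient at `0` of `s ↦ γ (1 / (1 + k s))`, whose derivative
there is `-k`. The sign of the limit thus tells, for large `m`, on which side of `u * (1 + k / m)`
the mean lies. -/
theorem tendsto_giniGamma_perturbed (q r : ℝ) {p : ℝ} (hp : 0 < p) (k : ℝ) :
    Tendsto (fun m : ℕ => giniGamma q r (p / (1 + k / m)) + m * giniGamma q r (1 / (1 + k / m)))
      atTop (𝓝 (giniGamma q r p - k)) := by
  have h0 : Tendsto (fun m : ℕ => k / (m : ℝ)) atTop (𝓝 0) :=
    tendsto_const_div_atTop_nhds_zero_nat k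
  have h1 : Tendsto (fun m : ℕ => p / (1 + k / (m : ℝ))) atTop (𝓝 p) := by
    simpa [Pi.div_def] using (tendsto_const_nhds (x := p)).div
      ((tendsto_const_nhds (x := (1 : ℝ))).add h0) (by norm_num)
  have h2 := ((continuousAt_giniGamma q r hp).tendsto).comp h1
  have hd : HasDerivAt (fun s : ℝ => giniGamma q r (1 / (1 + k * s))) (-k) 0 := by
    have hi : HasDerivAt (fun s : ℝ => 1 / (1 + k * s)) (-k) 0 := by
      simpa [one_div] using
        (((hasDerivAt_id (0 : ℝ)).const_mul k).const_add 1).fun_inv (by simp)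
    have hg : HasDerivAt (giniGamma q r) 1 (1 / (1 + k * 0)) := by
      have := hasDerivAt_giniGamma q r one_pos
      rw [giniGammaDeriv_one] at this
      simpa using this
    simpa [Function.comp_def] using hg.comp (0 : ℝ) hi
  have h3 : Tendsto (fun m : ℕ => (m : ℝ) * giniGamma q r (1 / (1 + k / m))) atTop (𝓝 (-k)) := by
    have hs := hd.tendsto_slope_zero_right.comp
      (tendsto_inv_atTop_nhdsGT_zero.comp (tendsto_natCast_atTop_atTop (R := ℝ)))
    refine hs.congr fun m => ?_
    simp [giniGamma_one, div_eq_mul_inv]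
  simpa [sub_eq_add_neg] using h2.add h3

theorem giniMean_cons_le_iff (q r : ℝ) (m : ℕ) {u p w : ℝ} (hu : 0 < u) (hp : 0 < p) (hw : 0 < w) :
    giniMean q r (m + 1) (Fin.cons (u * p) fun _ => u) ≤ u * w ↔
      giniGamma q r (p / w) + m * giniGamma q r (1 / w) ≤ 0 := by
  rw [(giniMean_compare q r (Nat.le_add_left 1 m) (fun i => ?_) (mul_pos hu hw)).1,
    Fin.sum_univ_succ]
  · simp only [Fin.cons_zero, Fin.cons_succ, Finset.sum_const, Finset.card_univ, Fintype.card_fin,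
      nsmul_eq_mul]
    rw [mul_div_mul_left _ _ hu.ne', div_mul_eq_div_div, div_self hu.ne']
  · refine Fin.cases ?_ (fun j => ?_) i
    · simpa using mul_pos hu hp
    · simpa using hu

theorem giniGamma_midpoint_le_of_isJensenConvexMeanOn {q r : ℝ} {I : Set ℝ} (hI : ∀ x ∈ I, 0 < x)
    (h : IsJensenConvexMeanOn (giniMean q r) I) {u s t : ℝ} (hu : u ∈ I) (hs : u * s ∈ I)
    (ht : u * t ∈ I) :
    2 * giniGamma q r ((s + t) / 2) ≤ giniGamma q r s + giniGamma q r t := by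
  have hu0 := hI u hu
  have hs0 : 0 < s := (mul_pos_iff_of_pos_left hu0).mp (hI _ hs)
  have ht0 : 0 < t := (mul_pos_iff_of_pos_left hu0).mp (hI _ ht)
  -- The slack `ε` makes `γ s < c` and `γ t < d` strict, so that the limits are negative and the
  -- bounds on the means hold eventually.
  refine le_of_forall_pos_le_add fun ε hε => ?_
  set c := giniGamma q r s + ε / 2 with hc
  set d := giniGamma q r t + ε / 2 with hd
  have hpos : ∀ k : ℝ, ∀ᶠ m : ℕ in atTop, 0 < 1 + k / (m : ℝ) := fun k => by
    have := (tendsto_const_nhds (x := (1 : ℝ))).add (tendsto_const_div_atTop_nhds_zero_nat k)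
    exact this.eventually_const_lt (by norm_num)
  have hev : ∀ p k : ℝ, 0 < p → giniGamma q r p < k → ∀ᶠ m : ℕ in atTop,
      giniMean q r (m + 1) (Fin.cons (u * p) fun _ => u) ≤ u * (1 + k / m) := by
    intro p k hp hk
    filter_upwards [hpos k, (tendsto_giniGamma_perturbed q r hp k).eventually_lt_const
      (sub_neg.mpr hk)] with m hm1 hm2
    exact (giniMean_cons_le_iff q r m hu0 hp hm1).mpr hm2.le
  have hmid : ∀ᶠ m : ℕ in atTop,
      giniGamma q r ((s + t) / 2 / (1 + (c + d) / 2 / m)) +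
        m * giniGamma q r (1 / (1 + (c + d) / 2 / m)) ≤ 0 := by
    filter_upwards [hev s c hs0 (by linarith), hev t d ht0 (by linarith), hpos ((c + d) / 2)]
      with m h1 h2 h3
    rw [← giniMean_cons_le_iff q r m hu0 (by positivity) h3]
    have hmem : ∀ p, u * p ∈ I → ∀ i, (Fin.cons (u * p) fun _ => u : Fin (m + 1) → ℝ) i ∈ I :=
      fun p hp i => by
        refine Fin.cases ?_ (fun j => ?_) i
        · simpa using hp
        · simpa using hu
    have := h (m + 1) (Nat.le_add_left 1 m) _ _ (hmem s hs) (hmem t ht)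
    have e : (fun i => ((Fin.cons (u * s) fun _ => u : Fin (m + 1) → ℝ) i +
        (Fin.cons (u * t) fun _ => u : Fin (m + 1) → ℝ) i) / 2) =
        (Fin.cons (u * ((s + t) / 2)) fun _ => u : Fin (m + 1) → ℝ) := by
      funext i
      refine Fin.cases ?_ (fun j => ?_) i
      · simp only [Fin.cons_zero]; ring
      · simp only [Fin.cons_succ]; ring
    rw [e] at this
    calc _ ≤ _ := this
      _ ≤ (u * (1 + c / m) + u * (1 + d / m)) / 2 := by linarith
      _ = _ := by ring
  have := le_of_tendsto (tendsto_giniGamma_perturbed q r (by positivity) ((c + d) / 2)) hmid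
  linarith

theorem giniGammaDerivTwo_nonneg_of_isJensenConvexMeanOn {q r a b : ℝ} (ha : 0 < a) (hab : a < b)
    (h : IsJensenConvexMeanOn (giniMean q r) (Set.Ioo a b)) {t : ℝ}
    (ht : t ∈ Set.Ioo (a / b) (b / a)) : 0 ≤ giniGammaDerivTwo q r t := by
  have hb := ha.trans hab
  have ht0 : 0 < t := (div_pos ha hb).trans ht.1
  -- Both `u` and `u * t` must lie in `(a, b)`; such a `u` exists because `a / b < t < b / a`.
  obtain ⟨u, hu1, hu2⟩ : ∃ u, max a (a / t) < u ∧ u < min b (b / t) := by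
    apply exists_between
    have h1 := (div_lt_iff₀ hb).mp ht.1
    have h2 := (lt_div_iff₀ ha).mp ht.2
    refine max_lt (lt_min hab ?_) (lt_min ?_ (div_lt_div_of_pos_right hab ht0))
    · rw [lt_div_iff₀ ht0]; linarith
    · rw [div_lt_iff₀ ht0]; linarith
  rw [max_lt_iff, div_lt_iff₀ ht0] at hu1
  rw [lt_min_iff, lt_div_iff₀ ht0] at hu2
  have hnhds : Set.Ioo a b ∈ 𝓝 (u * t) := Ioo_mem_nhds hu1.2 hu2.2
  refine giniGammaDerivTwo_nonneg_of_midpoint ht0 ?_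
  have h1 : ∀ᶠ δ in 𝓝 (0 : ℝ), u * (t - δ) ∈ Set.Ioo a b :=
    (Continuous.tendsto' (by fun_prop : Continuous fun δ : ℝ => u * (t - δ)) 0 (u * t)
      (by simp)) hnhds
  have h2 : ∀ᶠ δ in 𝓝 (0 : ℝ), u * (t + δ) ∈ Set.Ioo a b :=
    (Continuous.tendsto' (by fun_prop : Continuous fun δ : ℝ => u * (t + δ)) 0 (u * t)
      (by simp)) hnhds
  filter_upwards [h1, h2] with δ hd1 hd2
  have := giniGamma_midpoint_le_of_isJensenConvexMeanOn (fun x hx => ha.trans hx.1) h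
    ⟨hu1.1, hu2.1⟩ hd1 hd2
  rwa [show (t - δ + (t + δ)) / 2 = t by ring] at this

/-! ### The constant `β` and the cases for `q` and `r` -/

theorem GiniBetaDefined.symm {q r : ℝ} (h : GiniBetaDefined q r) : GiniBetaDefined r q := by
  rcases h with ⟨h, h'⟩ | ⟨rfl, h⟩
  · exact Or.inl ⟨Ne.symm h, by linarith⟩
  · exact Or.inr ⟨rfl, h⟩

theorem giniBetaDefined_comm {q r : ℝ} : GiniBetaDefined q r ↔ GiniBetaDefined r q :=
  ⟨GiniBetaDefined.symm, GiniBetaDefined.symm⟩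

theorem GiniBetaDefined.mul_pos {q r : ℝ} (h : GiniBetaDefined q r) :
    0 < q * (q - 1) * (r * (r - 1)) := by
  rcases h with ⟨-, h⟩ | ⟨rfl, h⟩
  · linarith
  · exact mul_self_pos.mpr h

theorem giniBetaDefined_of_mul_pos {q r : ℝ} (h : 0 < q * (q - 1) * (r * (r - 1))) :
    GiniBetaDefined q r := by
  by_cases hqr : q = r
  · exact Or.inr ⟨hqr, left_ne_zero_of_mul h.ne'⟩
  · exact Or.inl ⟨hqr, by linarith⟩

theorem giniBeta_pos {q r : ℝ} (h : GiniBetaDefined q r) : 0 < giniBeta q r := by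
  by_cases hqr : q = r
  · simp only [giniBeta, ne_eq, hqr, not_true_eq_false, if_false]
    exact Real.exp_pos _
  · simp only [giniBeta, ne_eq, hqr, not_false_eq_true, if_true]
    refine Real.rpow_pos_of_pos ?_ _
    rcases pos_and_pos_or_neg_and_neg_of_mul_pos h.mul_pos with ⟨h1, h2⟩ | ⟨h1, h2⟩
    · exact div_pos h1 h2
    · exact div_pos_of_neg_of_neg h1 h2

theorem giniBeta_comm {q r : ℝ} (h : GiniBetaDefined q r) : giniBeta q r = giniBeta r q := by
  by_cases hqr : q = r
  · rw [hqr]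
  · have hpos : 0 ≤ r * (r - 1) / (q * (q - 1)) := by
      rcases pos_and_pos_or_neg_and_neg_of_mul_pos h.mul_pos with ⟨h1, h2⟩ | ⟨h1, h2⟩
      · exact (div_pos h2 h1).le
      · exact (div_pos_of_neg_of_neg h2 h1).le
    simp only [giniBeta, ne_eq, hqr, Ne.symm hqr, not_false_eq_true, if_true]
    rw [← inv_div (r * (r - 1)), Real.inv_rpow hpos, ← Real.rpow_neg hpos, ← one_div_neg_eq_neg_one_div,
      neg_sub]

theorem giniGammaDerivTwo_comm (q r t : ℝ) : giniGammaDerivTwo q r t = giniGammaDerivTwo r q t := by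
  by_cases h : q = r
  · rw [h]
  · simp only [giniGammaDerivTwo, ne_eq, h, Ne.symm h, not_false_eq_true, if_true]
    rw [← neg_div_neg_eq, neg_sub, neg_sub]

theorem giniGammaDerivTwo_of_ne {q r : ℝ} (h : q ≠ r) {t : ℝ} (ht : 0 < t) :
    giniGammaDerivTwo q r t =
      t ^ (r - 2) * ((q * (q - 1) * t ^ (q - r) - r * (r - 1)) / (q - r)) := by
  have e : t ^ (q - 2) = t ^ (q - r) * t ^ (r - 2) := by
    rw [← Real.rpow_add ht]; ring_nf
  simp only [giniGammaDerivTwo, h, ne_eq, not_false_eq_true, if_true]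
  rw [e]
  ring

/-- Where `β` is defined, `γ''` has the sign of `q (q - 1) (log t + log β)`. -/
theorem giniGammaDerivTwo_nonneg_iff {q r : ℝ} (h : GiniBetaDefined q r) {t : ℝ} (ht : 0 < t) :
    0 ≤ giniGammaDerivTwo q r t ↔ 0 ≤ q * (q - 1) * (Real.log t + Real.log (giniBeta q r)) := by
  have hmul := h.mul_pos
  by_cases hqr : q = r
  · subst hqr
    have hq : q * (q - 1) ≠ 0 := left_ne_zero_of_mul hmul.ne'
    have h1 := left_ne_zero_of_mul hq
    have h2 := right_ne_zero_of_mul hq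
    simp only [giniGammaDerivTwo, giniBeta, ne_eq, not_true_eq_false, if_false, Real.log_exp]
    rw [mul_nonneg_iff_of_pos_right (Real.rpow_pos_of_pos ht _)]
    have e : q * (q - 1) * (Real.log t + (1 / q + 1 / (q - 1))) =
        q * (q - 1) * Real.log t + (2 * q - 1) := by
      field_simp
      ring
    rw [e]
  · have hc : q - r ≠ 0 := sub_ne_zero.mpr hqr
    have hT := Real.rpow_pos_of_pos ht (q - r)
    have hA : q * (q - 1) ≠ 0 := left_ne_zero_of_mul hmul.ne'
    have hB : r * (r - 1) ≠ 0 := right_ne_zero_of_mul hmul.ne'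
    have hAB : 0 < q * (q - 1) / (r * (r - 1)) := by
      rcases pos_and_pos_or_neg_and_neg_of_mul_pos hmul with ⟨h1, h2⟩ | ⟨h1, h2⟩
      · exact div_pos h1 h2
      · exact div_pos_of_neg_of_neg h1 h2
    have e : Real.log t + Real.log (giniBeta q r) =
        (Real.log (q * (q - 1) * t ^ (q - r)) - Real.log (r * (r - 1))) / (q - r) := by
      simp only [giniBeta, ne_eq, hqr, not_false_eq_true, if_true]
      rw [Real.log_rpow hAB, Real.log_div hA hB, Real.log_mul hA hT.ne', Real.log_rpow ht]
      field_simp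
      ring
    rw [giniGammaDerivTwo_of_ne hqr ht, mul_nonneg_iff_of_pos_left (Real.rpow_pos_of_pos ht _), e]
    rcases pos_and_pos_or_neg_and_neg_of_mul_pos hmul with ⟨h1, h2⟩ | ⟨h1, h2⟩
    · rw [mul_nonneg_iff_of_pos_left h1, log_sub_log_div_nonneg_iff (mul_pos h1 hT) h2 hc]
    -- Both products are negative here; `Real.log` is even, so the comparison is applied to their
    -- negatives.
    · have := log_sub_log_div_nonpos_iff (mul_pos (neg_pos.mpr h1) hT) (neg_pos.mpr h2) hc
      rw [neg_mul, Real.log_neg_eq_log, Real.log_neg_eq_log] at this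
      rw [← neg_mul_neg (q * (q - 1)) (_ / _), mul_nonneg_iff_of_pos_left (neg_pos.mpr h1), neg_nonneg,
        this, ← neg_nonneg, ← neg_div]
      ring_nf

/-- Here `γ'' t ≥ 0` means `t ≥ 1/β`, and by density this holds on the open interval exactly when
`1/β ≤ a/b`. -/
theorem forall_giniGammaDerivTwo_nonneg_iff_of_pos {q r : ℝ} (h : GiniBetaDefined q r)
    (hq : 0 < q * (q - 1)) {a b : ℝ} (ha : 0 < a) (hab : a < b) :
    (∀ t ∈ Set.Ioo (a / b) (b / a), 0 ≤ giniGammaDerivTwo q r t) ↔ b / a ≤ giniBeta q r := by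
  have hb := ha.trans hab
  have hβ := giniBeta_pos h
  have hlt : a / b < b / a := ((div_lt_one hb).mpr hab).trans ((one_lt_div ha).mpr hab)
  have key : ∀ t, 0 < t → (0 ≤ giniGammaDerivTwo q r t ↔ (giniBeta q r)⁻¹ ≤ t) := fun t ht => by
    rw [giniGammaDerivTwo_nonneg_iff h ht, mul_nonneg_iff_of_pos_left hq,
      ← Real.log_le_log_iff (inv_pos.mpr hβ) ht, Real.log_inv, neg_le_iff_add_nonneg]
  have hinv : b / a ≤ giniBeta q r ↔ (giniBeta q r)⁻¹ ≤ a / b := by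
    rw [← inv_div a b, inv_le_comm₀ (div_pos ha hb) hβ]
  rw [hinv]
  constructor
  · intro hP
    refine le_of_forall_gt_imp_ge_of_dense fun s hs => ?_
    obtain ⟨t, ht1, ht2⟩ := exists_between (lt_min hs hlt)
    rw [lt_min_iff] at ht2
    exact ((key t ((div_pos ha hb).trans ht1)).mp (hP t ⟨ht1, ht2.2⟩)).trans ht2.1.le
  · exact fun hP t ht => (key t ((div_pos ha hb).trans ht.1)).mpr (hP.trans ht.1.le)

theorem forall_giniGammaDerivTwo_nonneg_iff_of_neg {q r : ℝ} (h : GiniBetaDefined q r)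
    (hq : q * (q - 1) < 0) {a b : ℝ} (ha : 0 < a) (hab : a < b) :
    (∀ t ∈ Set.Ioo (a / b) (b / a), 0 ≤ giniGammaDerivTwo q r t) ↔ giniBeta q r ≤ a / b := by
  have hb := ha.trans hab
  have hβ := giniBeta_pos h
  have hlt : a / b < b / a := ((div_lt_one hb).mpr hab).trans ((one_lt_div ha).mpr hab)
  have key : ∀ t, 0 < t → (0 ≤ giniGammaDerivTwo q r t ↔ t ≤ (giniBeta q r)⁻¹) := fun t ht => by
    rw [giniGammaDerivTwo_nonneg_iff h ht, ← neg_mul_neg, mul_nonneg_iff_of_pos_left (neg_pos.mpr hq), neg_nonneg,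
      ← Real.log_le_log_iff ht (inv_pos.mpr hβ), Real.log_inv, le_neg_iff_add_nonpos_right]
  have hinv : giniBeta q r ≤ a / b ↔ b / a ≤ (giniBeta q r)⁻¹ := by
    rw [← inv_div b a, le_inv_comm₀ hβ (div_pos hb ha)]
  rw [hinv]
  constructor
  · intro hP
    refine le_of_forall_lt_imp_le_of_dense fun s hs => ?_
    obtain ⟨t, ht1, ht2⟩ := exists_between (max_lt hs hlt)
    rw [max_lt_iff] at ht1
    exact ht1.1.le.trans ((key t ((div_pos ha hb).trans ht1.2)).mp (hP t ⟨ht1.2, ht2⟩))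
  · exact fun hP t ht => (key t ((div_pos ha hb).trans ht.1)).mpr (ht.2.le.trans hP)

/-- Since `r (r - 1) ≤ 0 ≤ q (q - 1)`, no sign change can occur; this covers boundary exponents,
where `β` is undefined. -/
theorem giniGammaDerivTwo_nonneg_of_mem {q r t : ℝ} (ht : 0 < t) (hr0 : 0 ≤ r) (hr1 : r ≤ 1)
    (hq : 1 ≤ q) : 0 ≤ giniGammaDerivTwo q r t := by
  rcases (hr1.trans hq).lt_or_eq with h | rfl
  · rw [giniGammaDerivTwo_of_ne h.ne' ht]
    have h1 : 0 ≤ q * (q - 1) := mul_nonneg (by linarith) (by linarith)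
    have h2 : r * (r - 1) ≤ 0 := mul_nonpos_of_nonneg_of_nonpos hr0 (by linarith)
    have h3 := mul_nonneg h1 (Real.rpow_pos_of_pos ht (q - r)).le
    exact mul_nonneg (Real.rpow_pos_of_pos ht _).le (div_nonneg (by linarith) (by linarith))
  · obtain rfl : r = 1 := le_antisymm hr1 hq
    simp only [giniGammaDerivTwo, ne_eq, not_true_eq_false, if_false]
    norm_num
    positivity

theorem forall_giniGammaDerivTwo_nonneg_iff (q r : ℝ) {a b : ℝ} (ha : 0 < a) (hab : a < b) :
    (∀ t ∈ Set.Ioo (a / b) (b / a), 0 ≤ giniGammaDerivTwo q r t) ↔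
      (0 ≤ min q r ∧ min q r ≤ 1 ∧ 1 ≤ max q r) ∨
        (max q r < 1 ∧ 1 ≤ q + r ∧ GiniBetaDefined q r ∧ giniBeta q r ≤ a / b) ∨
        (min q r ≤ 0 ∧ 1 ≤ q + r ∧ GiniBetaDefined q r ∧ b / a ≤ giniBeta q r) ∨
        (1 ≤ min q r ∧ GiniBetaDefined q r ∧ b / a ≤ giniBeta q r) := by
  wlog hrq : r ≤ q generalizing q r
  · have h := this r q (le_of_not_ge hrq)
    simp only [giniGammaDerivTwo_comm r q, min_comm r q, max_comm r q, add_comm r q] at h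
    rw [h]
    -- `giniBeta_comm` needs `β` to be defined, so it is applied under the conjunction.
    have hβ : ∀ P : ℝ → Prop,
        (GiniBetaDefined r q ∧ P (giniBeta r q)) ↔ (GiniBetaDefined q r ∧ P (giniBeta q r)) :=
      fun P => by
        rw [giniBetaDefined_comm (q := r)]
        exact and_congr_right fun hd => by rw [giniBeta_comm hd]
    rw [hβ (· ≤ a / b), hβ (b / a ≤ ·)]
  have hb := ha.trans hab
  have h1 : (1 : ℝ) ∈ Set.Ioo (a / b) (b / a) := ⟨(div_lt_one hb).mpr hab, (one_lt_div ha).mpr hab⟩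
  rw [min_eq_right hrq, max_eq_left hrq]
  constructor
  · intro hP
    -- The value at `t = 1` gives `1 ≤ q + r`; with `r ≤ q < 1` this puts both exponents in `(0,
    -- 1)`.
    have hsum := hP 1 h1
    rw [giniGammaDerivTwo_one] at hsum
    rcases lt_or_ge q 1 with hq | hq
    · have hq' : q * (q - 1) < 0 := mul_neg_of_pos_of_neg (by linarith) (by linarith)
      have hr' : r * (r - 1) < 0 := mul_neg_of_pos_of_neg (by linarith) (by linarith)
      have hd := giniBetaDefined_of_mul_pos (mul_pos_of_neg_of_neg hq' hr')
      exact Or.inr (Or.inl ⟨hq, by linarith, hd,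
        (forall_giniGammaDerivTwo_nonneg_iff_of_neg hd hq' ha hab).mp hP⟩)
    rcases lt_or_ge r 0 with hr | hr
    · have hq' : 0 < q * (q - 1) := mul_pos (by linarith) (by linarith)
      have hr' : 0 < r * (r - 1) := mul_pos_of_neg_of_neg hr (by linarith)
      have hd := giniBetaDefined_of_mul_pos (mul_pos hq' hr')
      exact Or.inr (Or.inr (Or.inl ⟨hr.le, by linarith, hd,
        (forall_giniGammaDerivTwo_nonneg_iff_of_pos hd hq' ha hab).mp hP⟩))
    rcases le_or_gt r 1 with hr1 | hr1
    · exact Or.inl ⟨hr, hr1, hq⟩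
    · have hq' : 0 < q * (q - 1) := mul_pos (by linarith) (by linarith)
      have hr' : 0 < r * (r - 1) := mul_pos (by linarith) (by linarith)
      have hd := giniBetaDefined_of_mul_pos (mul_pos hq' hr')
      exact Or.inr (Or.inr (Or.inr ⟨hr1.le, hd,
        (forall_giniGammaDerivTwo_nonneg_iff_of_pos hd hq' ha hab).mp hP⟩))
  -- Definedness of `β` excludes `q = 1`.
  · have hpos : GiniBetaDefined q r → 1 ≤ q → 0 < q * (q - 1) := fun hd hq =>
      lt_of_le_of_ne (mul_nonneg (by linarith) (by linarith))
        (left_ne_zero_of_mul hd.mul_pos.ne').symm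
    rintro (⟨hr0, hr1, hq⟩ | ⟨hq, hqr, hd, hβ⟩ | ⟨hr, hqr, hd, hβ⟩ | ⟨hr, hd, hβ⟩)
    · exact fun t ht => giniGammaDerivTwo_nonneg_of_mem ((div_pos ha hb).trans ht.1) hr0 hr1 hq
    · exact (forall_giniGammaDerivTwo_nonneg_iff_of_neg hd
        (mul_neg_of_pos_of_neg (by linarith) (by linarith)) ha hab).mpr hβ
    · exact (forall_giniGammaDerivTwo_nonneg_iff_of_pos hd (hpos hd (by linarith)) ha hab).mpr hβ
    · exact (forall_giniGammaDerivTwo_nonneg_iff_of_pos hd (hpos hd (hr.trans hrq)) ha hab).mpr hβ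

theorem mainTheorem5 (q r a b : ℝ) (ha : 0 < a) (hab : a < b) :
    List.TFAE
      [ IsJensenConvexMeanOn (giniMean q r) (Set.Ioo a b),
        ConvexOn ℝ (Set.Icc (a / b) (b / a)) (giniGamma q r),
        (0 ≤ min q r ∧ min q r ≤ 1 ∧ 1 ≤ max q r) ∨
          (max q r < 1 ∧ 1 ≤ q + r ∧ GiniBetaDefined q r ∧ giniBeta q r ≤ a / b) ∨
          (min q r ≤ 0 ∧ 1 ≤ q + r ∧ GiniBetaDefined q r ∧ b / a ≤ giniBeta q r) ∨
          (1 ≤ min q r ∧ GiniBetaDefined q r ∧ b / a ≤ giniBeta q r) ] := by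
  have h12 : IsJensenConvexMeanOn (giniMean q r) (Set.Ioo a b) →
      ConvexOn ℝ (Set.Icc (a / b) (b / a)) (giniGamma q r) := fun h =>
    convexOn_giniGamma_of_nonneg (div_pos ha (ha.trans hab)) fun _ ht =>
      giniGammaDerivTwo_nonneg_of_isJensenConvexMeanOn ha hab h ht
  have h23 := forall_giniGammaDerivTwo_nonneg_iff q r ha hab
  tfae_have 1 → 2 := h12
  tfae_have 2 → 1 := isJensenConvexMeanOn_giniMean_of_convexOn ha
  tfae_have 2 → 3 := fun h => h23.mp fun t ht =>
    giniGammaDerivTwo_nonneg_of_convexOn h ((div_pos ha (ha.trans hab)).trans ht.1)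
      (Icc_mem_nhds ht.1 ht.2)
  tfae_have 3 → 2 := fun h =>
    convexOn_giniGamma_of_nonneg (div_pos ha (ha.trans hab)) (h23.mpr h)
  tfae_finish
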